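/- Write a complex binary cubic as $f=a_0x^3+3a_1x^2y+3a_2xy^2+a_3y^3$, and let $SL(2)=SL(2,\mathbb C)$ act by linear substitutions of $(x,y)$. A polynomial $I\in\mathbb C[a_0,a_1,a_2,a_3]$ is an invariant of the binary cubic if its value at the coefficients of $f$ does not change under this action; the invariants of degree $m$ form the space $S^m(S^3\mathbb C^2)^{SL(2)}$. Let $$D=4(a_0a_2-a_1^2)(a_1a_3-a_2^2)-(a_0a_3-a_1a_2)^2$$ be the discriminant. (1) The spaces $S^m(S^3\mathbb C^2)^{SL(2)}$ are finite-dimensional and $$\sum_{m=0}^\infty \dim\bigl(S^m(S^3\mathbb C^2)^{SL(2)}\bigr)\,x^m=\frac1{1-x^4}.$$ The ring of invariants is freely generated by the discriminant: $\bigoplus_m S^m(S^3\mathbb C^2)^{SL(2)}=\mathbb C[D]$, with $D$ algebraically independent over $\mathbb C$. (2) Let $p_j=(p_{0j},p_{1j})$, $j=1,2,3$, be homogeneous coordinates of three points of $\mathbb P^1$, let $[jk]=p_{0j}p_{1k}-p_{1j}p_{0k}$ and $t_0=[12][23][31]$. Let $R_m$ be the space of polynomials in the six variables $p_{ij}$ that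 are homogeneous of degree $m$ in the coordinates of each of the three points, invariant under the simultaneous action of $SL(2)$ on the points, and invariant under all permutations of the points; $R=\bigoplus_m R_m$ is the invariant ring of three unordered points on $\mathbb P^1$. Then the $R_m$ are finite-dimensional, $\sum_{m=0}^\infty\dim(R_m)\,t^m=\frac1{1-t^4}$, and $R$ is freely generated by $t_0^2$, that is, $R=\mathbb C[t_0^2]$ with $t_0^2$ algebraically independent over $\mathbb C$. Moreover $t_0^2$ is, up to a constant, the discriminant: if $f=\prod_{j=1}^3(p_{0j}x+p_{1j}y)$, then $t_0^2(p)=27\,D(f)$. -/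

import Mathlib

open MvPolynomial

namespace BinaryForm

/-- The binary form `∑ i, (d choose i) a_i x^(d-i) y^i` of degree `d` with coefficients `a_0, …, a_d`
(with `x = X 0` and `y = X 1`). -/
noncomputable def form (d : ℕ) (a : Fin (d + 1) → ℂ) : MvPolynomial (Fin 2) ℂ :=
  ∑ i : Fin (d + 1), C ((d.choose i : ℂ) * a i) * (X 0 ^ (d - (i : ℕ)) * X 1 ^ (i : ℕ))

/-- The linear substitution `f(v) ↦ f(g v)` in a polynomial in two variables. -/
noncomputable def subst (g : Matrix.SpecialLinearGroup (Fin 2) ℂ) :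
    MvPolynomial (Fin 2) ℂ →ₐ[ℂ] MvPolynomial (Fin 2) ℂ :=
  bind₁ fun i => ∑ j, C (g.1 i j) * X j

/-- The ring of invariants of binary forms of degree `d`: the polynomials `I` in the coefficients
`a_0, …, a_d` such that `I(b) = I(a)` whenever the form with coefficients `b` arises from the form
with coefficients `a` by a linear substitution of determinant `1`. -/
noncomputable def invariantRing (d : ℕ) : Subalgebra ℂ (MvPolynomial (Fin (d + 1)) ℂ) where
  carrier := {I | ∀ (g : Matrix.SpecialLinearGroup (Fin 2) ℂ) (a b : Fin (d + 1) → ℂ),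
    form d b = subst g (form d a) → eval b I = eval a I}
  mul_mem' := by
    intro I J hI hJ g a b h
    rw [map_mul, map_mul, hI g a b h, hJ g a b h]
  add_mem' := by
    intro I J hI hJ g a b h
    rw [map_add, map_add, hI g a b h, hJ g a b h]
  algebraMap_mem' := by
    intro r g a b _
    simp [algebraMap_eq]

/-- The space of invariants of degree `m` of binary forms of degree `d`. -/
noncomputable def invariantsOfDegree (d m : ℕ) : Submodule ℂ (MvPolynomial (Fin (d + 1)) ℂ) :=
  Subalgebra.toSubmodule (invariantRing d) ⊓ homogeneousSubmodule (Fin (d + 1)) ℂ m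

/-- The discriminant of the binary cubic `a_0 x^3 + 3 a_1 x^2 y + 3 a_2 x y^2 + a_3 y^3`. -/
noncomputable def cubicDiscriminant : MvPolynomial (Fin 4) ℂ :=
  4 * (X 0 * X 2 - X 1 ^ 2) * (X 1 * X 3 - X 2 ^ 2) - (X 0 * X 3 - X 1 * X 2) ^ 2

/-- Comparison with the normalization in which the coefficients of the cubic carry no binomial
factors. -/
theorem eval_cubicDiscriminant (a : Fin 4 → ℂ) :
    27 * eval a cubicDiscriminant = (Cubic.mk (a 0) (3 * a 1) (3 * a 2) (a 3)).discr := by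
  simp [cubicDiscriminant, Cubic.discr]
  ring

/-- The weight on the coordinate ring of `d` points: the `i`-th coordinate of the `j`-th point
(the variable `(i, j)`) has as multidegree the `j`-th unit vector. -/
def pointWeight (d : ℕ) (v : Fin 2 × Fin d) : Fin d → ℕ := Pi.single v.2 1

/-- The invariant ring of `d` unordered points on the projective line (for the weight `(1, …, 1)`).
The variable `(i, j)` is the `i`-th homogeneous coordinate of the `j`-th point; the elements are the
polynomials all of whose monomials have the same degree in the coordinates of each point, and which
are invariant under the simultaneous action of `SL(2)` on the points and under all permutations of
the points. -/
noncomputable def unorderedPointRing (d : ℕ) : Subalgebra ℂ (MvPolynomial (Fin 2 × Fin d) ℂ) where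
  carrier := {F |
    (∀ s ∈ F.support, ∃ m : ℕ, Finsupp.weight (pointWeight d) s = fun _ => m) ∧
    (∀ (g : Matrix.SpecialLinearGroup (Fin 2) ℂ) (p : Matrix (Fin 2) (Fin d) ℂ),
      eval (fun v => (g.1 * p) v.1 v.2) F = eval (fun v => p v.1 v.2) F) ∧
    (∀ (σ : Equiv.Perm (Fin d)) (p : Matrix (Fin 2) (Fin d) ℂ),
      eval (fun v => p v.1 (σ v.2)) F = eval (fun v => p v.1 v.2) F)}
  mul_mem' := by
    rintro F G ⟨hF, hF', hF''⟩ ⟨hG, hG', hG''⟩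
    refine ⟨fun s hs => ?_, fun g p => ?_, fun σ p => ?_⟩
    · classical
      obtain ⟨u, hu, v, hv, rfl⟩ := Finset.mem_add.mp (support_mul F G hs)
      obtain ⟨m, hm⟩ := hF u hu
      obtain ⟨n, hn⟩ := hG v hv
      exact ⟨m + n, by rw [map_add, hm, hn]; rfl⟩
    · rw [map_mul, map_mul, hF', hG']
    · rw [map_mul, map_mul, hF'', hG'']
  add_mem' := by
    rintro F G ⟨hF, hF', hF''⟩ ⟨hG, hG', hG''⟩
    refine ⟨fun s hs => ?_, fun g p => ?_, fun σ p => ?_⟩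
    · classical
      rcases Finset.mem_union.mp (support_add hs) with h | h
      · exact hF s h
      · exact hG s h
    · rw [map_add, map_add, hF', hG']
    · rw [map_add, map_add, hF'', hG'']
  algebraMap_mem' := by
    intro r
    refine ⟨fun s hs => ⟨0, ?_⟩, fun g p => by simp [algebraMap_eq],
      fun σ p => by simp [algebraMap_eq]⟩
    have h : s = 0 := by
      classical
      by_contra hne
      rw [algebraMap_eq, mem_support_iff, coeff_C, if_neg (Ne.symm hne)] at hs
      exact hs rfl
    rw [h, map_zero]
    rfl

/-- The space of invariants of `d` unordered points on the projective line that have degree `m` in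
the coordinates of each point. -/
noncomputable def unorderedPointInvariants (d m : ℕ) :
    Submodule ℂ (MvPolynomial (Fin 2 × Fin d) ℂ) :=
  Subalgebra.toSubmodule (unorderedPointRing d) ⊓
    weightedHomogeneousSubmodule ℂ (pointWeight d) (fun _ => m)

/-- The bracket `[j k]` of two of `d` points on the projective line. -/
noncomputable def bracket {d : ℕ} (j k : Fin d) : MvPolynomial (Fin 2 × Fin d) ℂ :=
  X (0, j) * X (1, k) - X (1, j) * X (0, k)

/-- The invariant `t₀ = [12][23][31]` of three ordered points on the projective line. -/
noncomputable def threePointInvariant : MvPolynomial (Fin 2 × Fin 3) ℂ :=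
  bracket 0 1 * bracket 1 2 * bracket 2 0

/-- The Hilbert series `∑ m, (dim M_m) x^m` of a sequence of vector spaces. -/
noncomputable def hilbertSeries {A : Type*} [AddCommGroup A] [Module ℂ A]
    (M : ℕ → Submodule ℂ A) : PowerSeries ℚ :=
  PowerSeries.mk fun m => (Module.finrank ℂ (M m) : ℚ)

end BinaryForm

namespace BinaryForm

/-! Both rings are computed by restricting invariants to a one-parameter slice that meets every
generic orbit. A cubic whose discriminant and leading Hessian coefficient are nonzero is a sum of
two cubes of linear forms, hence equivalent under SL(2) to `x^3 + T y^3`, where `D = -T^2`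
(`eval_eq_of_hessian`). An invariant thus becomes a polynomial in `T`; a residual symmetry `T ↦ -T`
makes it even, hence a polynomial in `-D`. Three distinct points move, up to rescaling, to a fixed
frame with one scale `s`, where `t₀ = s^2` (`eval_eq_of_sq_eq`). Swapping two points replaces `s` by
`i s`, so only powers of `s^4 = t₀^2` survive. In each case the identity holds off a proper closed
set, hence everywhere. The Hilbert series follows because the powers of the generator lie in
distinct degrees. -/

theorem eval_polynomial_aeval {σ : Type*} (a : σ → ℂ) (F : MvPolynomial σ ℂ)
    (r : Polynomial ℂ) : eval a (Polynomial.aeval F r) = r.eval (eval a F) := by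
  simp [Polynomial.aeval_eq_sum_range, Polynomial.eval_eq_sum_range, smul_eval]

theorem polynomial_eval_aeval {σ : Type*} (f : σ → Polynomial ℂ) (F : MvPolynomial σ ℂ)
    (s : ℂ) : (aeval f F).eval s = eval (fun i => (f i).eval s) F := by
  induction F using MvPolynomial.induction_on with
  | C c => simp
  | add F G hF hG => simp [hF, hG]
  | mul_X F i hF => simp [hF]

/-! ### Graded pieces of the algebra generated by one homogeneous element -/

section Graded

variable {σ M : Type*} [AddCommMonoid M] {w : σ → M} {δ : ℕ →+ M} {d : ℕ}
  {F : MvPolynomial σ ℂ}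

/-- The components of a polynomial in a weighted homogeneous polynomial. -/
theorem weightedHomogeneousComponent_aeval (hF : IsWeightedHomogeneous w F (δ d))
    (r : Polynomial ℂ) (n : M) :
    weightedHomogeneousComponent w n (Polynomial.aeval F r) =
      ∑ᶠ k ∈ {k : ℕ | δ (k * d) = n}, r.coeff k • F ^ k := by
  classical
  have hpow : ∀ k : ℕ, IsWeightedHomogeneous w (F ^ k) (δ (k * d)) := fun k => by
    have h := hF.pow k
    rwa [← map_nsmul, smul_eq_mul] at h
  rw [Polynomial.aeval_eq_sum_range, map_sum, finsum_mem_eq_sum_of_inter_support_eq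
    (t := (Finset.range (r.natDegree + 1)).filter fun k => δ (k * d) = n)]
  · rw [Finset.sum_filter]
    refine Finset.sum_congr rfl fun k _ => ?_
    rw [map_smul]
    split_ifs with h
    · rw [← h, (hpow k).weightedHomogeneousComponent_same]
    · rw [(hpow k).weightedHomogeneousComponent_ne _ (Ne.symm h), smul_zero]
  · ext k
    simp only [Set.mem_inter_iff, Set.mem_ofPred_eq, Function.mem_support, Finset.coe_filter,
      Finset.mem_range]
    refine ⟨fun ⟨h, h'⟩ => ⟨⟨?_, h⟩, h'⟩, fun ⟨⟨_, h⟩, h'⟩ => ⟨h, h'⟩⟩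
    refine Nat.lt_succ_of_le (Polynomial.le_natDegree_of_ne_zero fun h0 => h' ?_)
    rw [h0, zero_smul]

theorem weightedHomogeneousComponent_aeval_mul (hδ : Function.Injective δ) (hd : 0 < d)
    (hF : IsWeightedHomogeneous w F (δ d)) (r : Polynomial ℂ) (k : ℕ) :
    weightedHomogeneousComponent w (δ (k * d)) (Polynomial.aeval F r) = r.coeff k • F ^ k := by
  have h : {j : ℕ | δ (j * d) = δ (k * d)} = {k} := by
    ext j
    simp [hδ.eq_iff, hd.ne']
  rw [weightedHomogeneousComponent_aeval hF, h, finsum_mem_singleton]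

theorem weightedHomogeneousComponent_aeval_of_not_dvd (hδ : Function.Injective δ)
    (hF : IsWeightedHomogeneous w F (δ d)) (r : Polynomial ℂ) {m : ℕ} (hm : ¬ d ∣ m) :
    weightedHomogeneousComponent w (δ m) (Polynomial.aeval F r) = 0 := by
  have h : {j : ℕ | δ (j * d) = δ m} = ∅ := by
    ext j
    simp only [hδ.eq_iff, Set.mem_ofPred_eq, Set.mem_empty_iff_false, iff_false]
    rintro rfl
    exact hm (dvd_mul_left _ _)
  rw [weightedHomogeneousComponent_aeval hF, h, finsum_mem_empty]

theorem algebraicIndependent_of_isWeightedHomogeneous (hδ : Function.Injective δ) (hd : 0 < d)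
    (hF : IsWeightedHomogeneous w F (δ d)) (h0 : F ≠ 0) : AlgebraicIndependent ℂ ![F] := by
  rw [algebraicIndependent_unique_type_iff, transcendental_iff]
  intro r hr
  ext k
  have h := weightedHomogeneousComponent_aeval_mul hδ hd hF r k
  simp only [Matrix.cons_val_fin_one] at hr
  rw [hr, map_zero] at h
  simpa [h0] using (smul_eq_zero.mp h.symm)

/-- `F ^ k` has degree `δ (k * d)`, so at most one power survives in degree `δ m`. The injection `δ`
covers both the usual grading and the diagonal multidegrees of point configurations. -/
theorem adjoin_inf_weightedHomogeneousSubmodule (hδ : Function.Injective δ) (hd : 0 < d)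
    (hF : IsWeightedHomogeneous w F (δ d)) (m : ℕ) :
    Subalgebra.toSubmodule (Algebra.adjoin ℂ {F}) ⊓ weightedHomogeneousSubmodule ℂ w (δ m) =
      if d ∣ m then Submodule.span ℂ {F ^ (m / d)} else ⊥ := by
  have key : ∀ G ∈ Subalgebra.toSubmodule (Algebra.adjoin ℂ {F}) ⊓
      weightedHomogeneousSubmodule ℂ w (δ m),
      ∃ r : Polynomial ℂ, weightedHomogeneousComponent w (δ m) (Polynomial.aeval F r) = G := by
    rintro G ⟨hG, hG'⟩
    rw [SetLike.mem_coe, Subalgebra.mem_toSubmodule,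
      Algebra.adjoin_singleton_eq_range_aeval] at hG
    obtain ⟨r, rfl⟩ := hG
    exact ⟨r, IsWeightedHomogeneous.weightedHomogeneousComponent_same hG'⟩
  split_ifs with h
  · obtain ⟨k, rfl⟩ := h
    rw [Nat.mul_div_cancel_left k hd, mul_comm d k] at *
    refine le_antisymm (fun G hG => ?_) ?_
    · obtain ⟨r, rfl⟩ := key G hG
      rw [weightedHomogeneousComponent_aeval_mul hδ hd hF]
      exact Submodule.smul_mem _ _ (Submodule.mem_span_singleton_self _)
    · rw [Submodule.span_singleton_le_iff_mem]
      have h := hF.pow k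
      rw [← map_nsmul, smul_eq_mul] at h
      have h' : F ^ k ∈ Algebra.adjoin ℂ {F} :=
        Subalgebra.pow_mem _ (Algebra.self_mem_adjoin_singleton ℂ F) k
      exact Submodule.mem_inf.mpr ⟨(Subalgebra.mem_toSubmodule _).mpr h', h⟩
  · refine (Submodule.eq_bot_iff _).mpr fun G hG => ?_
    obtain ⟨r, rfl⟩ := key G hG
    exact weightedHomogeneousComponent_aeval_of_not_dvd hδ hF r h

end Graded

/-! ### Hilbert series and root-of-unity symmetry -/

theorem mk_ite_dvd_eq_inv {d : ℕ} (hd : 0 < d) :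
    (PowerSeries.mk fun m => if d ∣ m then (1 : ℚ) else 0) = (1 - PowerSeries.X ^ d)⁻¹ := by
  rw [PowerSeries.eq_inv_iff_mul_eq_one (by simp [hd.ne'])]
  ext m
  rw [mul_sub, mul_one, map_sub, PowerSeries.coeff_mul_X_pow', PowerSeries.coeff_mk,
    PowerSeries.coeff_one]
  rcases lt_or_ge m d with h | h
  · rcases Nat.eq_zero_or_pos m with rfl | hm
    · simp [hd.ne']
    · simp [h.not_ge, hm.ne', Nat.not_dvd_of_pos_of_lt hm h]
  · have h' : d ∣ m - d ↔ d ∣ m := (Nat.dvd_sub_iff_left h dvd_rfl)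
    simp [h, h', (hd.trans_le h).ne']

/-- A sequence of lines spanned by the powers of a nonzero element, placed in the multiples of
`d`. -/
theorem finiteDimensional_and_hilbertSeries {A : Type*} [CommRing A] [IsDomain A] [Algebra ℂ A]
    {F : A} (hF : F ≠ 0) {d : ℕ} (hd : 0 < d) {N : ℕ → Submodule ℂ A}
    (hN : ∀ m, N m = if d ∣ m then Submodule.span ℂ {F ^ (m / d)} else ⊥) :
    (∀ m, FiniteDimensional ℂ (N m)) ∧ hilbertSeries N = (1 - PowerSeries.X ^ d)⁻¹ := by
  constructor
  · intro m
    by_cases h : d ∣ m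
    · rw [hN, if_pos h]
      infer_instance
    · rw [hN, if_neg h]
      infer_instance
  · rw [← mk_ite_dvd_eq_inv hd, hilbertSeries]
    congr 1
    ext m
    by_cases h : d ∣ m
    · rw [hN, if_pos h, if_pos h, finrank_span_singleton (pow_ne_zero _ hF), Nat.cast_one]
    · rw [hN, if_neg h, if_neg h, finrank_bot, Nat.cast_zero]

/-- A polynomial function invariant under multiplication by a primitive `n`-th root of unity is a
polynomial in the `n`-th power. -/
theorem exists_eq_expand_of_eval_mul_eq {n : ℕ} (hn : 0 < n) {ζ : ℂ} (hζ : IsPrimitiveRoot ζ n)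
    {q : Polynomial ℂ} (h : ∀ s : ℂ, s ≠ 0 → q.eval (ζ * s) = q.eval s) :
    ∃ r : Polynomial ℂ, q = Polynomial.expand ℂ n r := by
  have h' : q.comp (Polynomial.C ζ * Polynomial.X) = q := by
    -- The factor `X` absorbs the point `s = 0`, where nothing is assumed.
    have h1 : Polynomial.X * (q.comp (Polynomial.C ζ * Polynomial.X) - q) = 0 := by
      refine Polynomial.funext fun s => ?_
      rcases eq_or_ne s 0 with rfl | hs
      · simp
      · simp [Polynomial.eval_comp, h s hs]
    exact sub_eq_zero.mp ((mul_eq_zero.mp h1).resolve_left Polynomial.X_ne_zero)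
  refine ⟨Polynomial.contract n q, ?_⟩
  ext k
  rw [Polynomial.coeff_expand hn]
  split_ifs with hk
  · rw [Polynomial.coeff_contract hn.ne', Nat.div_mul_cancel hk]
  · have h2 : q.coeff k * ζ ^ k = q.coeff k := by
      conv_rhs => rw [← h', Polynomial.comp_C_mul_X_coeff]
    by_contra h3
    exact hk (hζ.dvd_of_pow_eq_one k (mul_left_cancel₀ h3 (h2.trans (mul_one _).symm)))

/-! ### Invariants of the binary cubic -/

theorem eval_form_three (a : Fin 4 → ℂ) (v : Fin 2 → ℂ) :
    eval v (form 3 a) =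
      a 0 * v 0 ^ 3 + 3 * a 1 * v 0 ^ 2 * v 1 + 3 * a 2 * v 0 * v 1 ^ 2 + a 3 * v 1 ^ 3 := by
  simp [form, Fin.sum_univ_four]
  ring

theorem eval_subst (g : Matrix.SpecialLinearGroup (Fin 2) ℂ) (f : MvPolynomial (Fin 2) ℂ)
    (v : Fin 2 → ℂ) : eval v (subst g f) = eval (g.1.mulVec v) f := by
  rw [subst, ← coe_aeval_eq_eval, ← coe_aeval_eq_eval, RingHom.coe_coe, RingHom.coe_coe,
    aeval_bind₁]
  congr 2
  ext i
  simp [Matrix.mulVec, dotProduct]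

theorem form_three_eq_subst_iff (g : Matrix.SpecialLinearGroup (Fin 2) ℂ) (a b : Fin 4 → ℂ) :
    form 3 b = subst g (form 3 a) ↔ ∀ x y : ℂ,
      b 0 * x ^ 3 + 3 * b 1 * x ^ 2 * y + 3 * b 2 * x * y ^ 2 + b 3 * y ^ 3 =
        a 0 * (g.1 0 0 * x + g.1 0 1 * y) ^ 3 +
        3 * a 1 * (g.1 0 0 * x + g.1 0 1 * y) ^ 2 * (g.1 1 0 * x + g.1 1 1 * y) +
        3 * a 2 * (g.1 0 0 * x + g.1 0 1 * y) * (g.1 1 0 * x + g.1 1 1 * y) ^ 2 +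
        a 3 * (g.1 1 0 * x + g.1 1 1 * y) ^ 3 := by
  constructor
  · intro h x y
    have h' := congrArg (eval ![x, y]) h
    simpa [eval_subst, eval_form_three, Matrix.mulVec, dotProduct, Fin.sum_univ_two] using h'
  · intro h
    refine MvPolynomial.funext fun v => ?_
    simpa [eval_subst, eval_form_three, Matrix.mulVec, dotProduct, Fin.sum_univ_two] using
      h (v 0) (v 1)

/-- The coefficients of a cubic are determined by its values. -/
theorem cubic_coeff_ext {a b : Fin 4 → ℂ}
    (h : ∀ x y : ℂ,
      a 0 * x ^ 3 + 3 * a 1 * x ^ 2 * y + 3 * a 2 * x * y ^ 2 + a 3 * y ^ 3 =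
      b 0 * x ^ 3 + 3 * b 1 * x ^ 2 * y + 3 * b 2 * x * y ^ 2 + b 3 * y ^ 3) : a = b := by
  have h0 : a 0 = b 0 := by linear_combination h 1 0
  have h3 : a 3 = b 3 := by linear_combination h 0 1
  have h1 := h 1 1
  have h2 := h 1 (-1)
  ext i
  fin_cases i
  · exact h0
  · change a 1 = b 1
    linear_combination (h1 - h2) / 6 - h3 / 3
  · change a 2 = b 2
    linear_combination (h1 + h2) / 6 - h0 / 3
  · exact h3

theorem eval_cubicDiscriminant' (a : Fin 4 → ℂ) :
    eval a cubicDiscriminant =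
      4 * (a 0 * a 2 - a 1 ^ 2) * (a 1 * a 3 - a 2 ^ 2) - (a 0 * a 3 - a 1 * a 2) ^ 2 := by
  simp [cubicDiscriminant]

theorem cubicDiscriminant_mem_invariantRing : cubicDiscriminant ∈ invariantRing 3 := by
  intro g a b h
  rw [form_three_eq_subst_iff] at h
  have hdet : g.1 0 0 * g.1 1 1 - g.1 0 1 * g.1 1 0 = 1 := by
    rw [← Matrix.det_fin_two, g.2]
  set α := g.1 0 0
  set β := g.1 0 1
  set γ := g.1 1 0
  set ε := g.1 1 1
  have hb : b = ![a 0 * α ^ 3 + 3 * a 1 * α ^ 2 * γ + 3 * a 2 * α * γ ^ 2 + a 3 * γ ^ 3,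
      a 0 * α ^ 2 * β + a 1 * (α ^ 2 * ε + 2 * α * β * γ) + a 2 * (β * γ ^ 2 + 2 * α * γ * ε) +
        a 3 * γ ^ 2 * ε,
      a 0 * α * β ^ 2 + a 1 * (β ^ 2 * γ + 2 * α * β * ε) + a 2 * (α * ε ^ 2 + 2 * β * γ * ε) +
        a 3 * γ * ε ^ 2,
      a 0 * β ^ 3 + 3 * a 1 * β ^ 2 * ε + 3 * a 2 * β * ε ^ 2 + a 3 * ε ^ 3] := by
    refine cubic_coeff_ext fun x y => (h x y).trans ?_
    simp
    ring
  -- The exponent is 6 = 4 · 3 / 2: degree of the invariant times degree of the form, over two.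
  have key : eval b cubicDiscriminant = (α * ε - β * γ) ^ 6 * eval a cubicDiscriminant := by
    rw [hb, eval_cubicDiscriminant', eval_cubicDiscriminant']
    simp
    ring
  rw [key, hdet, one_pow, one_mul]

/-- The substitution `diag(t, t⁻¹)` with `t^3 = A` carries `x^3 + A B y^3` to `A x^3 + B y^3`. -/
theorem eval_eq_of_torus {I : MvPolynomial (Fin 4) ℂ} (hI : I ∈ invariantRing 3) {A : ℂ}
    (hA : A ≠ 0) (B : ℂ) : eval ![A, 0, 0, B] I = eval ![1, 0, 0, A * B] I := by
  obtain ⟨t, ht⟩ := IsAlgClosed.exists_pow_nat_eq A (n := 3) (by norm_num)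
  have ht0 : t ≠ 0 := by rintro rfl; exact hA (by rw [← ht]; norm_num)
  refine hI ⟨!![t, 0; 0, t⁻¹], by simp [Matrix.det_fin_two, ht0]⟩ _ _
      ((form_three_eq_subst_iff _ _ _).mpr fun x y => ?_)
  simp only [Matrix.of_apply, Matrix.cons_val]
  rw [← ht]
  field_simp
  ring

/-- Off the zero sets of the discriminant and of the leading coefficient of the Hessian, the values
of an invariant are determined by its values on the cubics `x^3 + T y^3`. -/
theorem eval_eq_of_hessian {I : MvPolynomial (Fin 4) ℂ} (hI : I ∈ invariantRing 3)
    {a : Fin 4 → ℂ} (hD : eval a cubicDiscriminant ≠ 0) (hh : a 0 * a 2 - a 1 ^ 2 ≠ 0) :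
    ∃ T : ℂ, eval a cubicDiscriminant = -T ^ 2 ∧ eval a I = eval ![1, 0, 0, T] I := by
  rw [eval_cubicDiscriminant'] at hD
  obtain ⟨e, he⟩ := IsAlgClosed.exists_pow_nat_eq
    (-(4 * (a 0 * a 2 - a 1 ^ 2) * (a 1 * a 3 - a 2 ^ 2) - (a 0 * a 3 - a 1 * a 2) ^ 2))
    (n := 2) (by norm_num)
  have he0 : e ≠ 0 := by
    rintro rfl
    apply hD
    linear_combination he
  obtain ⟨h, hhe⟩ : ∃ h, h = a 0 * a 2 - a 1 ^ 2 := ⟨_, rfl⟩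
  rw [← hhe] at hh
  -- `r` and `s` are the roots of the Hessian `h z^2 + (a₀a₃ - a₁a₂) z + (a₁a₃ - a₂^2)`, whose
  -- discriminant is `-D = e^2`.
  obtain ⟨r, hr⟩ : ∃ r, r = (-(a 0 * a 3 - a 1 * a 2) + e) / (2 * h) := ⟨_, rfl⟩
  obtain ⟨s, hs⟩ : ∃ s, s = (-(a 0 * a 3 - a 1 * a 2) - e) / (2 * h) := ⟨_, rfl⟩
  have hsum : h * (r + s) = -(a 0 * a 3 - a 1 * a 2) := by
    rw [hr, hs]; field_simp; ring
  have hprod : h * (r * s) = a 1 * a 3 - a 2 ^ 2 := by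
    rw [hr, hs]; field_simp; rw [hhe]; linear_combination -he
  have hrs : r - s ≠ 0 := by
    have : r - s = e / h := by rw [hr, hs]; field_simp; ring
    rw [this]
    exact div_ne_zero he0 hh
  -- The coefficients satisfy a linear recurrence with characteristic roots `-r` and `-s`; solving
  -- it gives `f = A (x - r y)^3 + B (x - s y)^3`.
  have rec2 : a 2 = -(r + s) * a 1 - r * s * a 0 := by
    refine mul_left_cancel₀ hh ?_
    linear_combination a 1 * hsum + a 0 * hprod + a 2 * hhe
  have rec3 : a 3 = -(r + s) * a 2 - r * s * a 1 := by
    refine mul_left_cancel₀ hh ?_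
    linear_combination a 2 * hsum + a 1 * hprod + a 3 * hhe
  obtain ⟨A, hA⟩ : ∃ A, A = -(a 1 + s * a 0) / (r - s) := ⟨_, rfl⟩
  obtain ⟨B, hB⟩ : ∃ B, B = (a 1 + r * a 0) / (r - s) := ⟨_, rfl⟩
  have e0 : a 0 = A + B := by rw [hA, hB]; field_simp; ring
  have e1 : a 1 = -(r * A + s * B) := by rw [hA, hB]; field_simp; ring
  have e2 : a 2 = r ^ 2 * A + s ^ 2 * B := by rw [rec2, e0, e1]; ring
  have e3 : a 3 = -(r ^ 3 * A + s ^ 3 * B) := by rw [rec3, e2, e1]; ring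
  have hslice : eval a I = eval ![A, 0, 0, (r - s) ^ 3 * B] I := by
    -- The new variables are `x - r y` and `(x - s y) / (r - s)`, scaled to have determinant 1.
    refine hI ⟨!![1, -r; (r - s)⁻¹, -s * (r - s)⁻¹], ?_⟩ _ _
      ((form_three_eq_subst_iff _ _ _).mpr fun x y => ?_)
    · rw [Matrix.det_fin_two_of]
      field_simp
      ring
    · simp only [Matrix.of_apply, Matrix.cons_val]
      rw [e0, e1, e2, e3]
      field_simp
      ring
  have hdisc : eval a cubicDiscriminant = -(A * ((r - s) ^ 3 * B)) ^ 2 := by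
    rw [eval_cubicDiscriminant', e0, e1, e2, e3]
    ring
  have hA0 : A ≠ 0 := by
    rintro h0
    apply hD
    rw [← eval_cubicDiscriminant', hdisc, h0]
    ring
  exact ⟨A * ((r - s) ^ 3 * B), hdisc, hslice.trans (eval_eq_of_torus hI hA0 _)⟩

theorem cubicDiscriminant_ne_zero : cubicDiscriminant ≠ 0 := fun h => by
  have h' := eval_cubicDiscriminant' ![1, 0, 0, 1]
  rw [h] at h'
  simp at h'

theorem exists_eq_aeval_neg_cubicDiscriminant {I : MvPolynomial (Fin 4) ℂ}
    (hI : I ∈ invariantRing 3) :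
    ∃ r : Polynomial ℂ, I = Polynomial.aeval (-cubicDiscriminant) r := by
  let q : Polynomial ℂ :=
    aeval ![1, 0, 0, Polynomial.X] I
  have hq : ∀ T : ℂ, q.eval T = eval ![1, 0, 0, T] I := by
    intro T
    rw [polynomial_eval_aeval]
    congr 2
    ext i
    fin_cases i <;> simp
  obtain ⟨r, hr⟩ : ∃ r, q = Polynomial.expand ℂ 2 r := by
    refine exists_eq_expand_of_eval_mul_eq two_pos
      (IsPrimitiveRoot.neg_one 0 (by norm_num)) fun s hs => ?_
    -- `(x, y) ↦ (y, -x)` turns `x^3 - s y^3` into `s x^3 + y^3`, which the torus identifies with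
    -- `x^3 + s y^3`.
    rw [hq, hq, ← one_mul s, ← mul_comm s, ← eval_eq_of_torus hI hs]
    symm
    refine hI ⟨!![0, 1; -1, 0], by simp [Matrix.det_fin_two]⟩ _ _
      ((form_three_eq_subst_iff _ _ _).mpr fun x y => ?_)
    simp only [Matrix.of_apply, Matrix.cons_val]
    ring
  have hzero : cubicDiscriminant * (X 0 * X 2 - X 1 ^ 2) *
      (I - Polynomial.aeval (-cubicDiscriminant) r) = 0 := by
    refine MvPolynomial.funext fun a => ?_
    rw [map_mul, map_mul, map_zero]
    by_cases hD : eval a cubicDiscriminant = 0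
    · rw [hD, zero_mul, zero_mul]
    by_cases hh : a 0 * a 2 - a 1 ^ 2 = 0
    · simp [hh]
    obtain ⟨T, hT, hT'⟩ := eval_eq_of_hessian hI hD hh
    rw [map_sub (eval a) I, eval_polynomial_aeval, map_neg, hT, neg_neg, hT', ← hq, hr,
      Polynomial.expand_eval, sub_self, mul_zero]
  have hhess : (X 0 * X 2 - X 1 ^ 2 : MvPolynomial (Fin 4) ℂ) ≠ 0 := fun h => by
    have h' := congrArg (eval ![0, 1, 0, 0]) h
    simp at h'
  exact ⟨r, sub_eq_zero.mp
    ((mul_eq_zero.mp hzero).resolve_left (mul_ne_zero cubicDiscriminant_ne_zero hhess))⟩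

theorem invariantRing_three : invariantRing 3 = Algebra.adjoin ℂ {cubicDiscriminant} := by
  refine le_antisymm (fun I hI => ?_)
    (Algebra.adjoin_le (Set.singleton_subset_iff.mpr cubicDiscriminant_mem_invariantRing))
  obtain ⟨r, rfl⟩ := exists_eq_aeval_neg_cubicDiscriminant hI
  exact Algebra.adjoin_le (Set.singleton_subset_iff.mpr
      (Subalgebra.neg_mem _ (Algebra.self_mem_adjoin_singleton ℂ cubicDiscriminant)))
    (Polynomial.aeval_mem_adjoin_singleton ℂ _)

theorem isHomogeneous_cubicDiscriminant : cubicDiscriminant.IsHomogeneous 4 := by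
  have hX : ∀ i : Fin 4, (X i : MvPolynomial (Fin 4) ℂ).IsHomogeneous 1 := isHomogeneous_X ℂ
  have h4 : (4 : MvPolynomial (Fin 4) ℂ).IsHomogeneous 0 := isHomogeneous_C _ (4 : ℂ)
  exact ((h4.mul (((hX 0).mul (hX 2)).sub ((hX 1).pow 2))).mul
    (((hX 1).mul (hX 3)).sub ((hX 2).pow 2))).sub ((((hX 0).mul (hX 3)).sub
      ((hX 1).mul (hX 2))).pow 2)

/-! ### Invariants of three unordered points -/

theorem eval_threePointInvariant (p : Matrix (Fin 2) (Fin 3) ℂ) :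
    eval (fun v => p v.1 v.2) threePointInvariant =
      (p 0 0 * p 1 1 - p 1 0 * p 0 1) * (p 0 1 * p 1 2 - p 1 1 * p 0 2) *
        (p 0 2 * p 1 0 - p 1 2 * p 0 0) := by
  simp [threePointInvariant, bracket]

theorem isWeightedHomogeneous_bracket {d : ℕ} (j k : Fin d) :
    IsWeightedHomogeneous (pointWeight d) (bracket j k) (Pi.single j 1 + Pi.single k 1) := by
  have hX : ∀ v, IsWeightedHomogeneous (pointWeight d) (X v : MvPolynomial (Fin 2 × Fin d) ℂ)
    (Pi.single v.2 1) := isWeightedHomogeneous_X ℂ _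
  exact ((hX (0, j)).mul (hX (1, k))).sub ((hX (1, j)).mul (hX (0, k)))

theorem isWeightedHomogeneous_threePointInvariant_sq :
    IsWeightedHomogeneous (pointWeight 3) (threePointInvariant ^ 2) (fun _ => 4) := by
  have h := (((isWeightedHomogeneous_bracket (0 : Fin 3) 1).mul
    (isWeightedHomogeneous_bracket 1 2)).mul (isWeightedHomogeneous_bracket 2 0)).pow 2
  -- Each point occurs in two brackets, and squaring doubles this.
  have hw : 2 • (((Pi.single 0 1 : Fin 3 → ℕ) + Pi.single 1 1) + (Pi.single 1 1 + Pi.single 2 1) +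
      (Pi.single 2 1 + Pi.single 0 1)) = fun _ => 4 := by
    ext i
    fin_cases i <;> rfl
  rwa [hw] at h

theorem threePointInvariant_ne_zero : threePointInvariant ≠ 0 := fun h => by
  have h' := eval_threePointInvariant !![1, 0, -1; 0, 1, -1]
  rw [h] at h'
  simp at h'

theorem threePointInvariant_sq_mem_unorderedPointRing :
    threePointInvariant ^ 2 ∈ unorderedPointRing 3 := by
  refine ⟨fun s hs => ⟨4, isWeightedHomogeneous_threePointInvariant_sq (mem_support_iff.mp hs)⟩,
    fun g p => ?_, fun σ p => ?_⟩
  · have hdet : g.1 0 0 * g.1 1 1 - g.1 0 1 * g.1 1 0 = 1 := by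
      rw [← Matrix.det_fin_two, g.2]
    have key : eval (fun v => (g.1 * p) v.1 v.2) threePointInvariant =
        (g.1 0 0 * g.1 1 1 - g.1 0 1 * g.1 1 0) ^ 3 *
          eval (fun v => p v.1 v.2) threePointInvariant := by
      rw [eval_threePointInvariant, eval_threePointInvariant]
      simp only [Matrix.mul_apply, Fin.sum_univ_two]
      ring
    rw [map_pow, map_pow, key, hdet, one_pow, one_mul]
  · have h := eval_threePointInvariant (p.submatrix id σ)
    simp only [Matrix.submatrix_apply, id] at h
    rw [map_pow, map_pow, h, eval_threePointInvariant]
    have h01 : σ 0 ≠ σ 1 := σ.injective.ne (by decide)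
    have h02 : σ 0 ≠ σ 2 := σ.injective.ne (by decide)
    have h12 : σ 1 ≠ σ 2 := σ.injective.ne (by decide)
    generalize σ 0 = i at *
    generalize σ 1 = j at *
    generalize σ 2 = k at *
    clear h
    fin_cases i <;> fin_cases j <;> first | exact absurd rfl h01 | skip
    all_goals fin_cases k <;> first | exact absurd rfl h02 | exact absurd rfl h12 | skip
    all_goals simp only [Fin.zero_eta, Fin.mk_one, Fin.reduceFinMk]
    all_goals ring

/-- Rescaling the coordinates of the points changes the value of an invariant only through the
product of the factors. -/
theorem eval_scale {F : MvPolynomial (Fin 2 × Fin 3) ℂ} (hF : F ∈ unorderedPointRing 3)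
    (p : Matrix (Fin 2) (Fin 3) ℂ) {c c' : Fin 3 → ℂ} (h : ∏ j, c j = ∏ j, c' j) :
    eval (fun v => c v.2 * p v.1 v.2) F = eval (fun v => c' v.2 * p v.1 v.2) F := by
  have key : ∀ c : Fin 3 → ℂ, ∀ s ∈ F.support, ∀ m : ℕ,
      (Finsupp.weight (pointWeight 3) s = fun _ => m) →
      ∏ v, (c v.2 * p v.1 v.2) ^ s v = (∏ j, c j) ^ m * ∏ v, p v.1 v.2 ^ s v := by
    intro c s _ m hm
    have hs : ∀ j, s (0, j) + s (1, j) = m := by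
      intro j
      have := congrFun hm j
      rw [Finsupp.weight_apply, Finsupp.sum_fintype _ _ (by simp)] at this
      rw [← this, Finset.sum_apply, Fintype.sum_prod_type]
      simp [pointWeight, Pi.single_apply]
    simp only [mul_pow, Finset.prod_mul_distrib]
    congr 1
    rw [Fintype.prod_prod_type_right, ← Finset.prod_pow]
    refine Finset.prod_congr rfl fun j _ => ?_
    rw [Fin.prod_univ_two, ← pow_add, hs]
  rw [eval_eq', eval_eq']
  refine Finset.sum_congr rfl fun s hs => ?_
  obtain ⟨m, hm⟩ := hF.1 s hs
  rw [key c s hs m hm, key c' s hs m hm, h]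

/-- Three distinct points can be moved to the points `(1 : 0)`, `(0 : 1)`, `(1 : 1)`. -/
theorem eval_eq_of_sq_eq {F : MvPolynomial (Fin 2 × Fin 3) ℂ} (hF : F ∈ unorderedPointRing 3)
    (p : Matrix (Fin 2) (Fin 3) ℂ) {s : ℂ} (hs0 : s ≠ 0)
    (hs : s ^ 2 = eval (fun v => p v.1 v.2) threePointInvariant) :
    eval (fun v => p v.1 v.2) F =
      eval (fun v => (![s, 1, 1] : Fin 3 → ℂ) v.2 *
        (!![1, 0, -1; 0, 1, -1] : Matrix (Fin 2) (Fin 3) ℂ) v.1 v.2) F := by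
  rw [eval_threePointInvariant] at hs
  obtain ⟨u, hu⟩ : ∃ u, u = p 0 1 * p 1 2 - p 1 1 * p 0 2 := ⟨_, rfl⟩
  obtain ⟨v, hv⟩ : ∃ v, v = p 0 2 * p 1 0 - p 1 2 * p 0 0 := ⟨_, rfl⟩
  obtain ⟨w, hw⟩ : ∃ w, w = p 0 0 * p 1 1 - p 1 0 * p 0 1 := ⟨_, rfl⟩
  rw [← hu, ← hv, ← hw] at hs
  have hne : w * u * v ≠ 0 := hs ▸ pow_ne_zero 2 hs0
  have hu0 : u ≠ 0 := right_ne_zero_of_mul (left_ne_zero_of_mul hne)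
  have hv0 : v ≠ 0 := right_ne_zero_of_mul hne
  have hw0 : w ≠ 0 := left_ne_zero_of_mul (left_ne_zero_of_mul hne)
  -- Plücker relation: the brackets `u = [23]`, `v = [31]`, `w = [12]` are the coefficients of the
  -- linear dependence among three vectors in the plane.
  have pl0 : u * p 0 0 + v * p 0 1 + w * p 0 2 = 0 := by rw [hu, hv, hw]; ring
  have pl1 : u * p 1 0 + v * p 1 1 + w * p 1 2 = 0 := by rw [hu, hv, hw]; ring
  let g : Matrix.SpecialLinearGroup (Fin 2) ℂ :=
    ⟨!![u / s * p 0 0, v / s * p 0 1; u / s * p 1 0, v / s * p 1 1], by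
      rw [Matrix.det_fin_two_of]
      field_simp
      rw [hs, hw]
      ring⟩
  -- The product of these scales is `s^3 / (u v w) = s`, so they can be traded for `(s, 1, 1)`.
  let c : Fin 3 → ℂ := ![s / u, s / v, s / w]
  let N : Matrix (Fin 2) (Fin 3) ℂ := !![1, 0, -1; 0, 1, -1]
  have hp : p = g.1 * Matrix.of fun i j => c j * N i j := by
    ext i j
    rw [Matrix.mul_apply, Fin.sum_univ_two]
    fin_cases i <;> fin_cases j <;> simp [g, c, N] <;> field_simp
    · linear_combination pl0
    · linear_combination pl1
  rw [hp, hF.2.1]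
  refine eval_scale hF N ?_
  simp only [c, Fin.prod_univ_three, Matrix.cons_val]
  field_simp
  rw [hs]
  ring

theorem exists_eq_aeval_threePointInvariant_sq {F : MvPolynomial (Fin 2 × Fin 3) ℂ}
    (hF : F ∈ unorderedPointRing 3) :
    ∃ r : Polynomial ℂ, F = Polynomial.aeval (threePointInvariant ^ 2) r := by
  let N : Matrix (Fin 2) (Fin 3) ℂ := !![1, 0, -1; 0, 1, -1]
  let q : Polynomial ℂ :=
    aeval (fun v => (![Polynomial.X, 1, 1] : Fin 3 → Polynomial ℂ) v.2 *
      Polynomial.C (N v.1 v.2)) F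
  have hq : ∀ s : ℂ, q.eval s = eval (fun v => (![s, 1, 1] : Fin 3 → ℂ) v.2 * N v.1 v.2) F := by
    intro s
    rw [polynomial_eval_aeval]
    congr 2
    ext ⟨i, j⟩
    fin_cases j <;> simp [mul_comm s]
  obtain ⟨r, hr⟩ : ∃ r, q = Polynomial.expand ℂ 4 r := by
    refine exists_eq_expand_of_eval_mul_eq four_pos Complex.isPrimitiveRoot_I fun s hs => ?_
    let p : Matrix (Fin 2) (Fin 3) ℂ := Matrix.of fun i j => (![s, 1, 1] : Fin 3 → ℂ) j * N i j
    rw [hq, hq]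
    -- Swapping the first two points changes `t₀ = s^2` to `-s^2 = (i s)^2`.
    refine (eval_eq_of_sq_eq hF (p.submatrix id (Equiv.swap 0 1))
      (mul_ne_zero Complex.I_ne_zero hs) ?_).symm.trans (hF.2.2 (Equiv.swap 0 1) p)
    have h2 : Equiv.swap (0 : Fin 3) 1 2 = 2 := by decide
    rw [eval_threePointInvariant, mul_pow, Complex.I_sq]
    simp [p, N, h2]
    ring
  have hzero : threePointInvariant *
      (F - Polynomial.aeval (threePointInvariant ^ 2) r) = 0 := by
    refine MvPolynomial.funext fun x => ?_
    obtain ⟨p, rfl⟩ : ∃ p : Matrix (Fin 2) (Fin 3) ℂ, x = fun v => p v.1 v.2 :=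
      ⟨Matrix.of fun i j => x (i, j), rfl⟩
    rw [map_mul, map_zero]
    by_cases hD : eval (fun v => p v.1 v.2) threePointInvariant = 0
    · rw [hD, zero_mul]
    obtain ⟨s, hs⟩ := IsAlgClosed.exists_pow_nat_eq
      (eval (fun v => p v.1 v.2) threePointInvariant) (n := 2) two_pos
    have hs0 : s ≠ 0 := by
      rintro rfl
      exact hD (by rw [← hs]; norm_num)
    rw [map_sub (eval _) F, eval_polynomial_aeval, map_pow, ← hs, ← pow_mul,
      eval_eq_of_sq_eq hF p hs0 hs, ← hq, hr, Polynomial.expand_eval, sub_self, mul_zero]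
  exact ⟨r, sub_eq_zero.mp ((mul_eq_zero.mp hzero).resolve_left threePointInvariant_ne_zero)⟩

theorem unorderedPointRing_three :
    unorderedPointRing 3 = Algebra.adjoin ℂ {threePointInvariant ^ 2} := by
  refine le_antisymm (fun F hF => ?_) (Algebra.adjoin_le
    (Set.singleton_subset_iff.mpr threePointInvariant_sq_mem_unorderedPointRing))
  obtain ⟨r, rfl⟩ := exists_eq_aeval_threePointInvariant_sq hF
  exact Polynomial.aeval_mem_adjoin_singleton ℂ _

/-- The coefficients of the product determine `a` after division by the binomial factors 3, which
produce the 27. -/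
theorem threePointInvariant_sq_eq_discriminant (p : Matrix (Fin 2) (Fin 3) ℂ) (a : Fin 4 → ℂ)
    (h : form 3 a = ∏ j, (C (p 0 j) * X 0 + C (p 1 j) * X 1)) :
    eval (fun v => p v.1 v.2) (threePointInvariant ^ 2) = 27 * eval a cubicDiscriminant := by
  have ha : a = ![p 0 0 * p 0 1 * p 0 2,
      (p 0 0 * p 0 1 * p 1 2 + p 0 0 * p 1 1 * p 0 2 + p 1 0 * p 0 1 * p 0 2) / 3,
      (p 0 0 * p 1 1 * p 1 2 + p 1 0 * p 0 1 * p 1 2 + p 1 0 * p 1 1 * p 0 2) / 3,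
      p 1 0 * p 1 1 * p 1 2] := by
    refine cubic_coeff_ext fun x y => ?_
    have h' := congrArg (eval ![x, y]) h
    simp only [eval_form_three, Fin.prod_univ_three, map_mul, map_add, eval_C, eval_X,
      Matrix.cons_val] at h'
    rw [h']
    simp only [Matrix.cons_val]
    ring
  rw [map_pow, eval_threePointInvariant, eval_cubicDiscriminant', ha]
  simp only [Matrix.cons_val]
  ring

end BinaryForm

theorem mainTheorem4 :
    -- invariants of the binary cubic
    ((∀ m : ℕ, FiniteDimensional ℂ (BinaryForm.invariantsOfDegree 3 m)) ∧
      BinaryForm.hilbertSeries (BinaryForm.invariantsOfDegree 3) =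
        (1 - PowerSeries.X ^ 4)⁻¹ ∧
      BinaryForm.invariantRing 3 = Algebra.adjoin ℂ {BinaryForm.cubicDiscriminant} ∧
      AlgebraicIndependent ℂ ![BinaryForm.cubicDiscriminant]) ∧
    -- invariants of three unordered points on the projective line
    ((∀ m : ℕ, FiniteDimensional ℂ (BinaryForm.unorderedPointInvariants 3 m)) ∧
      BinaryForm.hilbertSeries (BinaryForm.unorderedPointInvariants 3) =
        (1 - PowerSeries.X ^ 4)⁻¹ ∧
      BinaryForm.unorderedPointRing 3 =
        Algebra.adjoin ℂ {BinaryForm.threePointInvariant ^ 2} ∧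
      AlgebraicIndependent ℂ ![BinaryForm.threePointInvariant ^ 2]) ∧
    -- `t₀ ^ 2` is the discriminant (up to the scalar `27`) of the cubic given by the three points
    (∀ (p : Matrix (Fin 2) (Fin 3) ℂ) (a : Fin 4 → ℂ),
      BinaryForm.form 3 a =
        ∏ j, (MvPolynomial.C (p 0 j) * MvPolynomial.X 0 +
          MvPolynomial.C (p 1 j) * MvPolynomial.X 1) →
      MvPolynomial.eval (fun v => p v.1 v.2) (BinaryForm.threePointInvariant ^ 2) =
        27 * MvPolynomial.eval a BinaryForm.cubicDiscriminant) := by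

  refine ⟨?_, ?_, BinaryForm.threePointInvariant_sq_eq_discriminant⟩
  · have hδ : Function.Injective (AddMonoidHom.id ℕ) := fun _ _ h => h
    have hF : MvPolynomial.IsWeightedHomogeneous 1 BinaryForm.cubicDiscriminant
      (AddMonoidHom.id ℕ 4) := BinaryForm.isHomogeneous_cubicDiscriminant
    have h := BinaryForm.finiteDimensional_and_hilbertSeries BinaryForm.cubicDiscriminant_ne_zero
      four_pos (N := BinaryForm.invariantsOfDegree 3) fun m => by
        rw [← BinaryForm.adjoin_inf_weightedHomogeneousSubmodule hδ four_pos hF,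
          ← BinaryForm.invariantRing_three]
        rfl
    exact ⟨h.1, h.2, BinaryForm.invariantRing_three,
      BinaryForm.algebraicIndependent_of_isWeightedHomogeneous hδ four_pos hF
        BinaryForm.cubicDiscriminant_ne_zero⟩
  -- Degree `m` in every point is the diagonal multidegree `(m, m, m)`.
  · let δ : ℕ →+ (Fin 3 → ℕ) := Pi.constAddMonoidHom (Fin 3) ℕ
    have hδ : Function.Injective δ := fun _ _ h => congrFun h 0
    have hF : MvPolynomial.IsWeightedHomogeneous (BinaryForm.pointWeight 3)
      (BinaryForm.threePointInvariant ^ 2) (δ 4) :=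
      BinaryForm.isWeightedHomogeneous_threePointInvariant_sq
    have h0 := pow_ne_zero 2 BinaryForm.threePointInvariant_ne_zero
    have h := BinaryForm.finiteDimensional_and_hilbertSeries h0
      four_pos (N := BinaryForm.unorderedPointInvariants 3) fun m => by
        rw [← BinaryForm.adjoin_inf_weightedHomogeneousSubmodule hδ four_pos hF,
          ← BinaryForm.unorderedPointRing_three]
        rfl
    exact ⟨h.1, h.2, BinaryForm.unorderedPointRing_three,
      BinaryForm.algebraicIndependent_of_isWeightedHomogeneous hδ four_pos hF h0⟩
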